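/- For integers $n\ge 1$ and $N\ge 0$ let $p_{n,N}$ be the probability that $N$ independent points, each uniformly distributed on the unit sphere $S^{n-1}\subset\mathbb R^n$, are hemispherical, i.e. that their convex hull does not contain the origin (equivalently, that they all lie in some open hemisphere). (1) (Wendel's formula) For all $n,N\ge 1$, $$p_{n,N}=\frac1{2^{N-1}}\sum_{i=0}^{n-1}\binom{N-1}{i}.$$ Let $\beta>0$ and, for every $n$, let $K_a(n)\in\{\lfloor\beta n\rfloor,\lceil\beta n\rceil\}$ (so $K_a(n)=\beta n$ whenever $\beta n$ is an integer). Say that $p_{n,K_a(n)}\to1$ exponentially if there is a constant $c>0$ such that $|p_{n,K_a(n)}-1|\le e^{-cn}$ for all sufficiently large $n$. (2) $p_{n,K_a(n)}\to 1$ exponentially, with $p_{n,K_a(n)}<1$ for all sufficiently large $n$, if and only if $1<\beta<2$. Moreover, if $\beta>1$, then $p_{n,K_a(n)}\to 1$ exponentially if and only if $\beta<2$. (3) If $0<\beta\le1$, then $p_{n,K_a(n)}=1$ for every $n\ge1$. -/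

import Mathlib

open MeasureTheory Filter

/-- The uniform probability measure on the unit sphere `S^{n-1}` of `ℝⁿ` (for `n ≥ 1`): the surface
measure induced by Lebesgue measure, divided by its total mass. -/
noncomputable def uniformSphere (n : ℕ) :
    Measure (Metric.sphere (0 : EuclideanSpace ℝ (Fin n)) 1) :=
  ((volume : Measure (EuclideanSpace ℝ (Fin n))).toSphere Set.univ)⁻¹ •
    (volume : Measure (EuclideanSpace ℝ (Fin n))).toSphere

theorem isProbabilityMeasure_uniformSphere {n : ℕ} (hn : 1 ≤ n) :
    IsProbabilityMeasure (uniformSphere n) := by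
  have : Nonempty (Fin n) := ⟨⟨0, hn⟩⟩
  constructor
  rw [uniformSphere, Measure.smul_apply, smul_eq_mul]
  refine ENNReal.inv_mul_cancel ?_ (measure_ne_top _ _)
  rw [Ne, Measure.measure_univ_eq_zero]
  exact Measure.toSphere_ne_zero _

/-- A finite family of points of `ℝⁿ` is hemispherical if its convex hull does not contain the
origin. -/
def Hemispherical {n N : ℕ} (x : Fin N → EuclideanSpace ℝ (Fin n)) : Prop :=
  (0 : EuclideanSpace ℝ (Fin n)) ∉ convexHull ℝ (Set.range x)

/-- Being hemispherical means that all the points lie strictly on one side of a hyperplane through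
the origin. -/
theorem hemispherical_iff {n N : ℕ} (x : Fin N → EuclideanSpace ℝ (Fin n)) :
    Hemispherical x ↔ ∃ u : EuclideanSpace ℝ (Fin n), ∀ i, 0 < inner ℝ u (x i) := by
  constructor
  · intro h
    obtain ⟨f, a, h0, hf⟩ := geometric_hahn_banach_point_closed (convex_convexHull ℝ (Set.range x))
      ((Set.finite_range x).isClosed_convexHull ℝ) h
    refine ⟨(InnerProductSpace.toDual ℝ _).symm f, fun i => ?_⟩
    rw [InnerProductSpace.toDual_symm_apply]
    have h1 := hf (x i) (subset_convexHull ℝ _ ⟨i, rfl⟩)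
    rw [map_zero] at h0
    exact h0.trans h1
  · rintro ⟨u, hu⟩ h
    have hc : Convex ℝ {y : EuclideanSpace ℝ (Fin n) | 0 < inner ℝ u y} :=
      convex_halfSpace_gt (innerSL ℝ u).toLinearMap.isLinear 0
    have h2 : (0 : EuclideanSpace ℝ (Fin n)) ∈ {y | 0 < inner ℝ u y} :=
      convexHull_min (by rintro _ ⟨i, rfl⟩; exact hu i) hc h
    simp at h2

/-- `p_{n,N}`: the probability that `N` independent uniform points of `S^{n-1}` are
hemispherical. -/
noncomputable def hemisphericalProb (n N : ℕ) : ℝ :=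
  (Measure.pi fun _ : Fin N => uniformSphere n).real
    {x | Hemispherical fun i => (x i : EuclideanSpace ℝ (Fin n))}

/-- The real sequence `a` converges to `l` exponentially fast. -/
def ConvergesExponentially (a : ℕ → ℝ) (l : ℝ) : Prop :=
  ∃ c : ℝ, 0 < c ∧ ∀ᶠ n : ℕ in atTop, |a n - l| ≤ Real.exp (-c * n)

/-! The uniform measure is invariant under `x ↦ -x`, so flipping any of the `N` points leaves the
probability unchanged. Averaging over all `2 ^ N` flips, `p_{n,N}` is `2⁻ᴺ` times the expected
number of flips that make the points hemispherical. By `hemispherical_iff` these flips are the sign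
patterns of the functionals `⟨x i, ·⟩`, that is, the chambers of an arrangement of `N` hyperplanes.
Almost surely the points are in general position (`ae_inGeneralPosition`), and then the number of
chambers does not depend on them: deletion and restriction (`ncard_signPatterns_succ`) give Pascal's
recursion, solved in `ncard_signPatterns`. This is Wendel's formula.

It says that `p_{n,N}` is the probability that a symmetric binomial variable with `N - 1` trials is
less than `n`. For `N ≈ β n` the mean is about `β n / 2`. If `β < 2`, Chernoff's bound
(`one_sub_sum_range_choose_le`) gives exponential convergence; if `β ≥ 2`, symmetry keeps the
probability at most `1/2` (`two_mul_sum_range_choose_le`). If `β ≤ 1` the variable cannot reach `n`,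
and if `β > 1` it eventually can. -/

/-! ### General position -/

/-- A finite family of vectors is in `d`-general position if every nontrivial linear relation
between its members involves more than `d` of them. -/
def InGeneralPosition {V : Type*} [AddCommGroup V] [Module ℝ V] {N : ℕ} (d : ℕ)
    (f : Fin N → V) : Prop :=
  ∀ c : Fin N → ℝ, (Finset.univ.filter fun i => c i ≠ 0).card ≤ d → ∑ i, c i • f i = 0 → c = 0

theorem inGeneralPosition_iff_linearIndepOn {V : Type*} [AddCommGroup V] [Module ℝ V] {N d : ℕ}
    {f : Fin N → V} :
    InGeneralPosition d f ↔ ∀ s : Finset (Fin N), s.card ≤ d → LinearIndepOn ℝ f (s : Set (Fin N)) := by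
  constructor
  · intro h s hs
    rw [linearIndepOn_finset_iff]
    intro c hc i hi
    have := h (fun i => if i ∈ s then c i else 0) ?_ ?_
    · simpa [hi] using congrFun this i
    · refine (Finset.card_le_card fun i hi => ?_).trans hs
      by_contra h
      simp [h] at hi
    · simpa [ite_smul, Finset.sum_ite_mem] using hc
  · intro h c hc hsum
    have h1 := linearIndepOn_finset_iff.1 (h _ hc) c (by
      rw [← hsum]
      refine Finset.sum_subset (Finset.subset_univ _) fun i _ hi => ?_
      simp at hi
      simp [hi])
    funext i
    by_contra hi
    exact hi (h1 i (by simpa using hi))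

theorem card_filter_cons_ne_zero {N : ℕ} (a : ℝ) (c : Fin N → ℝ) :
    (Finset.univ.filter fun i => (Fin.cons a c : Fin (N + 1) → ℝ) i ≠ 0).card =
      (if a = 0 then 0 else 1) + (Finset.univ.filter fun i => c i ≠ 0).card := by
  rw [Fin.card_filter_univ_succ]
  by_cases ha : a = 0 <;> simp [ha, add_comm]

theorem InGeneralPosition.tail {V : Type*} [AddCommGroup V] [Module ℝ V] {N d : ℕ}
    {f : Fin (N + 1) → V} (h : InGeneralPosition d f) : InGeneralPosition d (Fin.tail f) := by
  intro c hc hsum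
  have := h (Fin.cons 0 c) (by simpa [card_filter_cons_ne_zero] using hc)
    (by simpa [Fin.sum_univ_succ, Fin.tail] using hsum)
  funext i
  simpa using congrFun this i.succ

/-- A relation that involves `v` can be solved for `v`, which puts it in the span of fewer than `d`
members of `f`. -/
theorem InGeneralPosition.cons {V : Type*} [AddCommGroup V] [Module ℝ V] {N d : ℕ}
    {f : Fin N → V} (h : InGeneralPosition d f) {v : V}
    (hv : ∀ s : Finset (Fin N), s.card < d → v ∉ Submodule.span ℝ (f '' s)) :
    InGeneralPosition d (Fin.cons v f : Fin (N + 1) → V) := by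
  intro c hc hsum
  obtain ⟨a, c, rfl⟩ : ∃ a c', c = Fin.cons a c' := ⟨_, _, (Fin.cons_self_tail c).symm⟩
  rw [card_filter_cons_ne_zero] at hc
  simp only [Fin.sum_univ_succ, Fin.cons_zero, Fin.cons_succ] at hsum
  by_cases ha : a = 0
  · subst ha
    have := h c (by simpa using hc) (by simpa using hsum)
    subst this
    funext i
    refine Fin.cases ?_ (fun i => ?_) i <;> simp
  · exfalso
    refine hv (Finset.univ.filter fun i => c i ≠ 0) (by simp [ha] at hc ⊢; omega) ?_
    have : v = -a⁻¹ • ∑ i, c i • f i := by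
      rw [← neg_eq_of_add_eq_zero_right hsum]
      simp [smul_smul, ha]
    rw [this]
    refine Submodule.smul_mem _ _ (Submodule.sum_mem _ fun i _ => ?_)
    by_cases hi : c i = 0
    · simp [hi]
    · exact Submodule.smul_mem _ _ (Submodule.subset_span ⟨i, by simpa using hi, rfl⟩)

theorem InGeneralPosition.head_ne_zero {V : Type*} [AddCommGroup V] [Module ℝ V] {N d : ℕ}
    {f : Fin (N + 1) → V} (h : InGeneralPosition (d + 1) f) : f 0 ≠ 0 := by
  intro h0
  have := h (Fin.cons 1 0) (by simp [card_filter_cons_ne_zero]) (by simp [Fin.sum_univ_succ, h0])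
  simpa using congrFun this 0

theorem InGeneralPosition.map {V W : Type*} [AddCommGroup V] [Module ℝ V] [AddCommGroup W]
    [Module ℝ W] {N d : ℕ} {f : Fin N → V} (h : InGeneralPosition d f) (g : V →ₗ[ℝ] W)
    (hg : Function.Injective g) : InGeneralPosition d (fun i => g (f i)) := by
  intro c hc hsum
  refine h c hc (hg ?_)
  simpa using hsum

/-- Restricting functionals to the kernel of the first one preserves general position. -/
theorem InGeneralPosition.restrict_ker {V : Type*} [AddCommGroup V] [Module ℝ V] {N d : ℕ}
    {f : Fin (N + 1) → V →ₗ[ℝ] ℝ} (h : InGeneralPosition (d + 1) f) :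
    InGeneralPosition d (fun i : Fin N => (f i.succ).domRestrict (LinearMap.ker (f 0))) := by
  intro c hc hsum
  have hk : ∀ u ∈ LinearMap.ker (f 0), (∑ i, c i • f i.succ) u = 0 := by
    intro u hu
    simpa using congrArg (fun g => g (⟨u, hu⟩ : LinearMap.ker (f 0))) hsum
  have h0 := h.head_ne_zero
  obtain ⟨w, hw⟩ : ∃ w, f 0 w ≠ 0 := by
    by_contra! hw
    exact h0 (LinearMap.ext hw)
  -- A functional vanishing on `ker (f 0)` is a multiple of `f 0`. Adding this multiple gives a
  -- relation with at most one more nonzero coefficient, whence `d + 1`.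
  have := h (Fin.cons (-((∑ i, c i • f i.succ) w / f 0 w)) c) ?_ ?_
  · funext i
    simpa using congrFun this i.succ
  · rw [card_filter_cons_ne_zero]
    split_ifs <;> omega
  · ext u
    have := hk (u - (f 0 u / f 0 w) • w) (by simp [hw])
    rw [map_sub, map_smul, sub_eq_zero, smul_eq_mul] at this
    simp only [Fin.sum_univ_succ, Fin.cons_zero, Fin.cons_succ, LinearMap.add_apply, this,
      LinearMap.smul_apply, smul_eq_mul, LinearMap.zero_apply]
    ring

/-! ### Counting chambers of a hyperplane arrangement -/

/-- The real number `1` or `-1` encoded by a Boolean. -/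
def boolSign (b : Bool) : ℝ := if b then 1 else -1

/-- The sign patterns that the functionals `f i` attain at vectors where none of them vanishes. -/
def signPatterns {V : Type*} [AddCommGroup V] [Module ℝ V] {N : ℕ} (f : Fin N → V →ₗ[ℝ] ℝ) :
    Set (Fin N → Bool) :=
  {ε | ∃ u, ∀ i, 0 < boolSign (ε i) * f i u}

theorem exists_pos_forall_sign_add_smul {V : Type*} [AddCommGroup V] [Module ℝ V] {N : ℕ}
    {f : Fin N → V →ₗ[ℝ] ℝ} {ε : Fin N → Bool} {u : V} (hu : ∀ i, 0 < boolSign (ε i) * f i u)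
    (w : V) : ∃ δ : ℝ, 0 < δ ∧ ∀ i, 0 < boolSign (ε i) * f i (u + δ • w) := by
  have h : ∀ i, ∀ᶠ δ : ℝ in nhds 0, 0 < boolSign (ε i) * f i (u + δ • w) := fun i => by
    have hc : Continuous fun δ : ℝ => boolSign (ε i) * f i (u + δ • w) := by
      simp only [map_add, map_smul, smul_eq_mul]
      fun_prop
    exact hc.tendsto 0 (lt_mem_nhds (by simpa using hu i))
  have h2 := (eventually_all.2 h).filter_mono (nhdsWithin_le_nhds (s := Set.Ioi (0 : ℝ)))
  obtain ⟨δ, h3, h4⟩ := (h2.and self_mem_nhdsWithin).exists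
  exact ⟨δ, h4, h3⟩

/-- Deletion and restriction: a chamber of the remaining functionals is cut in two by the hyperplane
`f 0 = 0` exactly when it meets that hyperplane, and so contributes one extra pattern. -/
theorem ncard_signPatterns_succ {V : Type*} [AddCommGroup V] [Module ℝ V] {N : ℕ}
    (f : Fin (N + 1) → V →ₗ[ℝ] ℝ) (h0 : f 0 ≠ 0) :
    (signPatterns f).ncard = (signPatterns (Fin.tail f)).ncard +
      (signPatterns fun i : Fin N => (f i.succ).domRestrict (LinearMap.ker (f 0))).ncard := by
  obtain ⟨w, hw⟩ : ∃ w, 0 < f 0 w := by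
    by_contra! hw
    refine h0 (LinearMap.ext fun u => le_antisymm (hw u) ?_)
    simpa using hw (-u)
  let A (b : Bool) : Set (Fin N → Bool) :=
    {ε | ∃ u, 0 < boolSign b * f 0 u ∧ ∀ i, 0 < boolSign (ε i) * f i.succ u}
  have hA : signPatterns f = (fun ε => Fin.cons true ε) '' A true ∪
      (fun ε => Fin.cons false ε) '' A false := by
    ext ε
    obtain ⟨b, ε, rfl⟩ : ∃ b ε', ε = Fin.cons b ε' := ⟨_, _, (Fin.cons_self_tail ε).symm⟩
    cases b <;> simp [signPatterns, A, Fin.forall_fin_succ]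
  have hinj (b : Bool) :
      Function.Injective fun ε : Fin N → Bool => (Fin.cons b ε : Fin (N + 1) → Bool) :=
    fun _ _ h => Fin.cons_right_injective (α := fun _ => Bool) b h
  have hunion : A true ∪ A false = signPatterns (Fin.tail f) := by
    ext ε
    constructor
    · rintro (⟨u, -, hu⟩ | ⟨u, -, hu⟩) <;> exact ⟨u, hu⟩
    · rintro ⟨u, hu⟩
      rcases lt_trichotomy (f 0 u) 0 with h | h | h
      · exact Or.inr ⟨u, by simpa [boolSign] using h, hu⟩
      · obtain ⟨δ, hδ, h1⟩ := exists_pos_forall_sign_add_smul hu w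
        exact Or.inl ⟨_, by simp [boolSign, h, mul_pos hδ hw], h1⟩
      · exact Or.inl ⟨u, by simpa [boolSign] using h, hu⟩
  have hinter : A true ∩ A false =
      signPatterns fun i : Fin N => (f i.succ).domRestrict (LinearMap.ker (f 0)) := by
    ext ε
    constructor
    · rintro ⟨⟨u, hu0, hu⟩, ⟨v, hv0, hv⟩⟩
      simp only [boolSign, if_true, one_mul, Bool.false_eq_true, if_false, neg_mul] at hu0 hv0
      -- Since `f 0 u > 0 > f 0 v`, this is a positive combination of `u` and `v`: up to scale, the
      -- point where the segment between them crosses the hyperplane.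
      refine ⟨⟨f 0 u • v - f 0 v • u, by simp [mul_comm]⟩, fun i => ?_⟩
      have h1 := mul_pos hu0 (hv i)
      have h2 := mul_pos hv0 (hu i)
      simp only [LinearMap.domRestrict_apply, map_sub, map_smul, smul_eq_mul]
      linarith
    · rintro ⟨⟨u, hu0⟩, hu⟩
      rw [LinearMap.mem_ker] at hu0
      replace hu : ∀ i, 0 < boolSign (ε i) * Fin.tail f i u := hu
      obtain ⟨δ, hδ, h1⟩ := exists_pos_forall_sign_add_smul hu w
      obtain ⟨η, hη, h2⟩ := exists_pos_forall_sign_add_smul hu (-w)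
      exact ⟨⟨_, by simp [boolSign, hu0, mul_pos hδ hw], h1⟩,
        ⟨_, by simp [boolSign, hu0, mul_pos hη hw], h2⟩⟩
  have hdisj : Disjoint ((fun ε => Fin.cons true ε) '' A true : Set (Fin (N + 1) → Bool))
      ((fun ε => Fin.cons false ε) '' A false) := by
    rw [Set.disjoint_left]
    rintro _ ⟨x, -, rfl⟩ ⟨y, -, hxy⟩
    simpa using congrFun hxy 0
  rw [hA, Set.ncard_union_eq hdisj, Set.ncard_image_of_injective _ (hinj _),
    Set.ncard_image_of_injective _ (hinj _), ← Set.ncard_union_add_ncard_inter, hunion, hinter]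

theorem sum_range_succ_choose_succ (M d : ℕ) :
    ∑ i ∈ Finset.range (d + 1), (M + 1).choose i =
      ∑ i ∈ Finset.range (d + 1), M.choose i + ∑ i ∈ Finset.range d, M.choose i := by
  rw [Finset.sum_range_succ', Finset.sum_range_succ' (fun i => M.choose i)]
  simp only [Nat.choose_succ_succ, Finset.sum_add_distrib, Nat.choose_zero_right,
    Nat.succ_eq_add_one]
  omega

/-- The number of chambers of a linear hyperplane arrangement in general position. -/
theorem ncard_signPatterns {N : ℕ} : ∀ {V : Type} [AddCommGroup V] [Module ℝ V]
    [FiniteDimensional ℝ V] (f : Fin (N + 1) → V →ₗ[ℝ] ℝ),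
    InGeneralPosition (Module.finrank ℝ V) f →
    (signPatterns f).ncard = 2 * ∑ i ∈ Finset.range (Module.finrank ℝ V), N.choose i := by
  have zero_dim : ∀ {N : ℕ} {V : Type} [AddCommGroup V] [Module ℝ V]
      [FiniteDimensional ℝ V] (f : Fin (N + 1) → V →ₗ[ℝ] ℝ), Module.finrank ℝ V = 0 →
      (signPatterns f).ncard = 0 := by
    intro N V _ _ _ f hd
    have := Module.finrank_zero_iff.1 hd
    rw [Set.ncard_eq_zero]
    refine Set.eq_empty_of_forall_notMem ?_
    rintro ε ⟨u, hu⟩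
    have := hu 0
    rw [Subsingleton.elim u 0, map_zero, mul_zero] at this
    exact lt_irrefl _ this
  have ker_dim : ∀ {V : Type} [AddCommGroup V] [Module ℝ V]
      [FiniteDimensional ℝ V] (g : V →ₗ[ℝ] ℝ) {d : ℕ}, g ≠ 0 → Module.finrank ℝ V = d + 1 →
      Module.finrank ℝ (LinearMap.ker g) = d := by
    intro V _ _ _ g d hg hd
    have := Module.Dual.finrank_ker_add_one_of_ne_zero hg
    omega
  -- `V` stays universally quantified because the induction step passes to `ker (f 0)`, of dimension
  -- one less.
  induction N with
  | zero =>
    intro V _ _ _ f hf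
    obtain hd | ⟨d, hd⟩ : Module.finrank ℝ V = 0 ∨ ∃ d, Module.finrank ℝ V = d + 1 :=
      (Nat.eq_zero_or_eq_succ_pred _).imp_right fun h => ⟨_, h⟩
    · rw [zero_dim f hd, hd]; simp
    · rw [hd] at hf ⊢
      rw [ncard_signPatterns_succ f hf.head_ne_zero, Finset.sum_range_succ']
      have : ∀ {W : Type} [AddCommGroup W] [Module ℝ W] (g : Fin 0 → W →ₗ[ℝ] ℝ),
          (signPatterns g).ncard = 1 := by
        intro W _ _ g
        rw [Set.ncard_eq_one]
        refine ⟨Fin.elim0, Set.eq_singleton_iff_unique_mem.2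
          ⟨⟨0, fun i => i.elim0⟩, fun x _ => Subsingleton.elim _ _⟩⟩
      simp [this]
  | succ N ih =>
    intro V _ _ _ f hf
    obtain hd | ⟨d, hd⟩ : Module.finrank ℝ V = 0 ∨ ∃ d, Module.finrank ℝ V = d + 1 :=
      (Nat.eq_zero_or_eq_succ_pred _).imp_right fun h => ⟨_, h⟩
    · rw [zero_dim f hd, hd]; simp
    · rw [hd] at hf
      have hk := ker_dim (f 0) hf.head_ne_zero hd
      have h1 := ih (Fin.tail f) (by rw [hd]; exact hf.tail)
      have h2 := ih (fun i : Fin (N + 1) => (f i.succ).domRestrict (LinearMap.ker (f 0)))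
        (by rw [hk]; exact hf.restrict_ker)
      rw [ncard_signPatterns_succ f hf.head_ne_zero, h1, h2, hd, hk,
        sum_range_succ_choose_succ, mul_add]

/-! ### Null sets and symmetry of the uniform measure -/

-- `toSphere` measures a set through the cone over it, and this cone stays inside a proper subspace,
-- which is Lebesgue-null.
open scoped Pointwise in
theorem uniformSphere_submodule {n : ℕ} (W : Submodule ℝ (EuclideanSpace ℝ (Fin n))) (hW : W ≠ ⊤) :
    uniformSphere n {x | (x : EuclideanSpace ℝ (Fin n)) ∈ W} = 0 := by
  have hm : MeasurableSet {x : Metric.sphere (0 : EuclideanSpace ℝ (Fin n)) 1 |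
      (x : EuclideanSpace ℝ (Fin n)) ∈ W} :=
    measurable_subtype_coe W.closed_of_finiteDimensional.measurableSet
  rw [uniformSphere, Measure.smul_apply, Measure.toSphere_apply' _ hm]
  have h0 : volume (Set.Ioo (0 : ℝ) 1 • ((↑) '' {x : Metric.sphere (0 : EuclideanSpace ℝ (Fin n)) 1 |
      (x : EuclideanSpace ℝ (Fin n)) ∈ W} : Set (EuclideanSpace ℝ (Fin n)))) = 0 := by
    refine measure_mono_null ?_ (Measure.addHaar_submodule volume W hW)
    rintro _ ⟨r, -, _, ⟨x, hx, rfl⟩, rfl⟩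
    exact W.smul_mem r hx
  rw [h0]
  simp

open scoped Pointwise in
theorem measurePreserving_neg_uniformSphere (n : ℕ) :
    MeasurePreserving (fun x => -x) (uniformSphere n) (uniformSphere n) := by
  have hm : Measurable fun x : Metric.sphere (0 : EuclideanSpace ℝ (Fin n)) 1 => -x :=
    continuous_neg.measurable
  have h : MeasurePreserving (fun x : Metric.sphere (0 : EuclideanSpace ℝ (Fin n)) 1 => -x)
      (volume : Measure (EuclideanSpace ℝ (Fin n))).toSphere
      (volume : Measure (EuclideanSpace ℝ (Fin n))).toSphere := by
    refine ⟨hm, Measure.ext fun s hs => ?_⟩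
    rw [Measure.map_apply hm hs, Measure.toSphere_apply' _ hs, Measure.toSphere_apply' _ (hm hs)]
    congr 1
    rw [← Measure.measure_neg volume (Set.Ioo (0 : ℝ) 1 • _), ← Set.smul_neg]
    congr 2
    ext y
    simp only [Set.mem_image, Set.mem_preimage, Set.mem_neg]
    constructor
    · rintro ⟨x, hx, hy⟩
      exact ⟨-x, hx, by simp [hy]⟩
    · rintro ⟨x, hx, hy⟩
      exact ⟨-x, by simpa using hx, by simp [hy]⟩
  exact h.smul_measure _

/-- Supplies the measurability that Fubini needs in `ae_inGeneralPosition`. -/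
theorem isOpen_setOf_inGeneralPosition {n N d : ℕ} :
    IsOpen {x : Fin N → EuclideanSpace ℝ (Fin n) | InGeneralPosition d x} := by
  simp only [inGeneralPosition_iff_linearIndepOn, Set.ofPred_forall]
  refine isOpen_iInter_of_finite fun s => isOpen_iInter_of_finite fun _ => ?_
  exact isOpen_setOfPred_linearIndependent.preimage
    (f := fun (x : Fin N → EuclideanSpace ℝ (Fin n)) (i : (s : Set (Fin N))) => x i) (by fun_prop)

theorem ae_inGeneralPosition {n : ℕ} (hn : 1 ≤ n) (N : ℕ) :
    ∀ᵐ x ∂(Measure.pi fun _ : Fin N => uniformSphere n),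
      InGeneralPosition n fun i => (x i : EuclideanSpace ℝ (Fin n)) := by
  have := isProbabilityMeasure_uniformSphere hn
  induction N with
  | zero => exact Eventually.of_forall fun x c _ _ => Subsingleton.elim _ _
  | succ N ih =>
    have hmeas : MeasurableSet {z : Metric.sphere (0 : EuclideanSpace ℝ (Fin n)) 1 ×
        (Fin N → Metric.sphere (0 : EuclideanSpace ℝ (Fin n)) 1) |
        InGeneralPosition n (Fin.cons (z.1 : EuclideanSpace ℝ (Fin n))
          fun i => (z.2 i : EuclideanSpace ℝ (Fin n)) : Fin (N + 1) → EuclideanSpace ℝ (Fin n))} := by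
      refine (isOpen_setOf_inGeneralPosition.preimage ?_).measurableSet
      refine continuous_pi fun i => Fin.cases ?_ (fun i => ?_) i
      · simp only [Fin.cons_zero]; fun_prop
      · simp only [Fin.cons_succ]; fun_prop
    have key : ∀ᵐ z ∂((uniformSphere n).prod (Measure.pi fun _ : Fin N => uniformSphere n)),
        InGeneralPosition n (Fin.cons (z.1 : EuclideanSpace ℝ (Fin n))
          fun i => (z.2 i : EuclideanSpace ℝ (Fin n)) : Fin (N + 1) → EuclideanSpace ℝ (Fin n)) := by
      -- Fix the other points first: the new point then only has to avoid finitely many proper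
      -- subspaces.
      rw [Measure.ae_prod_iff_ae_ae hmeas, Measure.ae_ae_comm hmeas]
      filter_upwards [ih] with y hy
      have hspan : ∀ s : Finset (Fin N), s.card < n → ∀ᵐ x : Metric.sphere (0 : EuclideanSpace ℝ (Fin n)) 1 ∂(uniformSphere n),
          (x : EuclideanSpace ℝ (Fin n)) ∉
            Submodule.span ℝ ((fun i => (y i : EuclideanSpace ℝ (Fin n))) '' s) := by
        intro s hs
        rw [ae_iff]
        simp only [not_not]
        refine uniformSphere_submodule _ fun htop => ?_
        classical
        have h1 := finrank_span_finset_le_card (R := ℝ)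
          (s.image fun i => (y i : EuclideanSpace ℝ (Fin n)))
        rw [Set.finrank, Finset.coe_image, htop, finrank_top, finrank_euclideanSpace_fin] at h1
        have := Finset.card_image_le (s := s) (f := fun i => (y i : EuclideanSpace ℝ (Fin n)))
        omega
      have hall : ∀ᵐ x : Metric.sphere (0 : EuclideanSpace ℝ (Fin n)) 1 ∂(uniformSphere n), ∀ s : Finset (Fin N), s.card < n →
          (x : EuclideanSpace ℝ (Fin n)) ∉
            Submodule.span ℝ ((fun i => (y i : EuclideanSpace ℝ (Fin n))) '' s) := by
        rw [ae_all_iff]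
        intro s
        by_cases hs : s.card < n
        · filter_upwards [hspan s hs] with x hx _ using hx
        · exact Eventually.of_forall fun x h => absurd h hs
      filter_upwards [hall] with x hx using hy.cons hx
    have hmp := (measurePreserving_piFinSuccAbove
      (fun _ : Fin (N + 1) => uniformSphere n) 0).quasiMeasurePreserving.ae key
    filter_upwards [hmp] with x hx
    convert hx using 1
    funext i
    refine Fin.cases ?_ (fun i => ?_) i <;> rfl

/-! ### Random signs and Wendel's formula -/

/-- The antipode of `x` if `b` is false, and `x` itself otherwise. -/
noncomputable def signFlip {n : ℕ} (b : Bool) (x : Metric.sphere (0 : EuclideanSpace ℝ (Fin n)) 1) :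
    Metric.sphere (0 : EuclideanSpace ℝ (Fin n)) 1 :=
  if b then x else -x

theorem coe_signFlip {n : ℕ} (b : Bool) (x : Metric.sphere (0 : EuclideanSpace ℝ (Fin n)) 1) :
    (signFlip b x : EuclideanSpace ℝ (Fin n)) = boolSign b • (x : EuclideanSpace ℝ (Fin n)) := by
  cases b <;> simp [signFlip, boolSign]

theorem measurePreserving_signFlip {n : ℕ} (b : Bool) :
    MeasurePreserving (signFlip b) (uniformSphere n) (uniformSphere n) := by
  cases b
  · simpa [signFlip, funext_iff] using! measurePreserving_neg_uniformSphere n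
  · exact MeasurePreserving.id _

theorem innerₗ_euclideanSpace_injective {n : ℕ} :
    Function.Injective (innerₗ (EuclideanSpace ℝ (Fin n))) := by
  rw [injective_iff_map_eq_zero]
  intro x hx
  simpa using congrArg (fun g => g x) hx

theorem hemispherical_signFlip_iff {n N : ℕ} (ε : Fin N → Bool)
    (x : Fin N → Metric.sphere (0 : EuclideanSpace ℝ (Fin n)) 1) :
    (Hemispherical fun i => (signFlip (ε i) (x i) : EuclideanSpace ℝ (Fin n))) ↔
      ε ∈ signPatterns fun i => innerₗ _ (x i : EuclideanSpace ℝ (Fin n)) := by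
  simp [hemispherical_iff, coe_signFlip, signPatterns, inner_smul_right, real_inner_comm]

theorem measurableSet_hemispherical (n N : ℕ) :
    MeasurableSet {x : Fin N → Metric.sphere (0 : EuclideanSpace ℝ (Fin n)) 1 |
      Hemispherical fun i => (x i : EuclideanSpace ℝ (Fin n))} := by
  simp only [hemispherical_iff, Set.ofPred_exists, Set.ofPred_forall]
  refine (isOpen_iUnion fun u => isOpen_iInter_of_finite fun i => ?_).measurableSet
  exact isOpen_lt continuous_const (by fun_prop)

theorem ncard_signPatterns_innerₗ {n N : ℕ} {x : Fin (N + 1) → EuclideanSpace ℝ (Fin n)}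
    (hx : InGeneralPosition n x) :
    (signPatterns fun i => innerₗ _ (x i)).ncard =
      2 * ∑ i ∈ Finset.range n, N.choose i := by
  have := ncard_signPatterns (fun i => innerₗ _ (x i))
    (by rw [finrank_euclideanSpace_fin]; exact hx.map _ innerₗ_euclideanSpace_injective)
  rwa [finrank_euclideanSpace_fin] at this

/-- Double counting over flips and configurations: the integrand, the number of hemispherical flips,
is almost everywhere the chamber count. -/
theorem two_pow_mul_measure_hemispherical {n : ℕ} (hn : 1 ≤ n) (N : ℕ) :
    2 ^ (N + 1) * (Measure.pi fun _ : Fin (N + 1) => uniformSphere n)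
      {x | Hemispherical fun i => (x i : EuclideanSpace ℝ (Fin n))} =
      (2 * ∑ i ∈ Finset.range n, N.choose i : ℕ) := by
  classical
  have := isProbabilityMeasure_uniformSphere hn
  set μ := Measure.pi fun _ : Fin (N + 1) => uniformSphere n
  set H := {x : Fin (N + 1) → Metric.sphere (0 : EuclideanSpace ℝ (Fin n)) 1 |
    Hemispherical fun i => (x i : EuclideanSpace ℝ (Fin n))} with hH
  have hmp (ε : Fin (N + 1) → Bool) : MeasurePreserving (fun x i => signFlip (ε i) (x i)) μ μ :=
    measurePreserving_pi _ _ fun i => measurePreserving_signFlip (ε i)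
  have hHm : MeasurableSet H := measurableSet_hemispherical n (N + 1)
  have hAm (ε : Fin (N + 1) → Bool) := (hmp ε).measurable hHm
  calc 2 ^ (N + 1) * μ H = ∑ _ε : Fin (N + 1) → Bool, μ H := by simp
    _ = ∑ ε : Fin (N + 1) → Bool, μ ((fun x i => signFlip (ε i) (x i)) ⁻¹' H) :=
        Finset.sum_congr rfl fun ε _ => ((hmp ε).measure_preimage hHm.nullMeasurableSet).symm
    _ = ∑ ε : Fin (N + 1) → Bool,
          ∫⁻ x, ((fun x i => signFlip (ε i) (x i)) ⁻¹' H).indicator 1 x ∂μ :=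
        Finset.sum_congr rfl fun ε _ => (lintegral_indicator_one (hAm ε)).symm
    _ = ∫⁻ x, ∑ ε : Fin (N + 1) → Bool,
          ((fun x i => signFlip (ε i) (x i)) ⁻¹' H).indicator 1 x ∂μ :=
        (lintegral_finsetSum _ fun ε _ => measurable_one.indicator (hAm ε)).symm
    _ = ∫⁻ _x, ((2 * ∑ i ∈ Finset.range n, N.choose i : ℕ) : ENNReal) ∂μ := by
        refine lintegral_congr_ae ?_
        filter_upwards [ae_inGeneralPosition hn (N + 1)] with x hx
        rw [← ncard_signPatterns_innerₗ hx, Set.ncard_eq_toFinset_card']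
        simp [Set.indicator_apply, hH, hemispherical_signFlip_iff, Set.toFinset]
    _ = _ := by simp

/-- Wendel's formula. -/
theorem hemisphericalProb_eq {n N : ℕ} (hn : 1 ≤ n) (hN : 1 ≤ N) :
    hemisphericalProb n N =
      (∑ i ∈ Finset.range n, ((N - 1).choose i : ℝ)) / 2 ^ (N - 1) := by
  obtain ⟨N, rfl⟩ := Nat.exists_eq_add_of_le' hN
  have h := congrArg ENNReal.toReal (two_pow_mul_measure_hemispherical hn N)
  rw [ENNReal.toReal_mul, ENNReal.toReal_pow, ENNReal.toReal_ofNat, ENNReal.toReal_natCast] at h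
  rw [hemisphericalProb, measureReal_def, Nat.add_sub_cancel, eq_div_iff (by positivity)]
  push_cast [pow_succ] at h
  linarith

theorem hemisphericalProb_zero {n : ℕ} (hn : 1 ≤ n) : hemisphericalProb n 0 = 1 := by
  have := isProbabilityMeasure_uniformSphere hn
  have h : {x : Fin 0 → Metric.sphere (0 : EuclideanSpace ℝ (Fin n)) 1 |
      Hemispherical fun i => (x i : EuclideanSpace ℝ (Fin n))} = Set.univ :=
    Set.eq_univ_of_forall fun x => (hemispherical_iff _).2 ⟨0, fun i => i.elim0⟩
  rw [hemisphericalProb, h, probReal_univ]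

/-! ### Partial sums of binomial coefficients -/

/-- The reflection `i ↦ M - i` sends the first `n` indices to the last `n`, and the hypothesis makes
the two blocks disjoint. -/
theorem two_mul_sum_range_choose_le {n M : ℕ} (h : 2 * n ≤ M + 1) :
    2 * ∑ i ∈ Finset.range n, M.choose i ≤ 2 ^ M := by
  have h1 : ∑ i ∈ Finset.range n, M.choose i = ∑ i ∈ (Finset.range n).image (M - ·), M.choose i := by
    rw [Finset.sum_image]
    · refine Finset.sum_congr rfl fun i hi => (Nat.choose_symm ?_).symm
      have := Finset.mem_range.1 hi
      omega
    · intro i hi j hj hij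
      simp only [Finset.coe_range, Set.mem_Iio] at hi hj hij
      omega
  have hd : Disjoint (Finset.range n) ((Finset.range n).image (M - ·)) := by
    rw [Finset.disjoint_left]
    intro i hi hj
    simp only [Finset.mem_image, Finset.mem_range] at hi hj
    omega
  rw [two_mul]
  nth_rewrite 2 [h1]
  rw [← Finset.sum_union hd, ← Nat.sum_range_choose]
  refine Finset.sum_le_sum_of_subset fun i hi => ?_
  simp only [Finset.mem_union, Finset.mem_image, Finset.mem_range] at hi ⊢
  omega

theorem sum_range_choose_of_lt {n M : ℕ} (h : M < n) :
    ∑ i ∈ Finset.range n, M.choose i = 2 ^ M := by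
  rw [← Nat.sum_range_choose]
  refine (Finset.sum_subset (fun i hi => ?_) fun i _ hi => ?_).symm
  · simp only [Finset.mem_range] at hi ⊢
    omega
  · exact Nat.choose_eq_zero_of_lt (by simpa using hi)

theorem sum_range_choose_lt {n M : ℕ} (h : n ≤ M) :
    ∑ i ∈ Finset.range n, M.choose i < 2 ^ M := by
  rw [← Nat.sum_range_choose]
  refine Finset.sum_lt_sum_of_subset (i := M) (fun i hi => ?_) (by simp) (by simpa) (by simp)
    fun _ _ _ => Nat.zero_le _
  simp only [Finset.mem_range] at hi ⊢
  omega

/-- Chernoff's bound for the upper tail of the symmetric binomial distribution. -/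
theorem one_sub_sum_range_choose_le (n M : ℕ) {s : ℝ} (hs : 0 ≤ s) :
    1 - (∑ i ∈ Finset.range n, (M.choose i : ℝ)) / 2 ^ M ≤
      Real.exp (M * (s + s ^ 2 / 2) - 2 * s * n) := by
  have htot : ∑ i ∈ Finset.range (M + 1), (M.choose i : ℝ) = 2 ^ M := by
    exact_mod_cast Nat.sum_range_choose M
  -- Exponential tilting: the weight is at least `1` on the tail `i ≥ n` and positive elsewhere.
  have h1 : 2 ^ M - ∑ i ∈ Finset.range n, (M.choose i : ℝ) ≤
      ∑ i ∈ Finset.range (M + 1), (M.choose i : ℝ) * Real.exp (2 * s * (i - n)) := by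
    have h2 : ∑ i ∈ Finset.range (M + 1), (M.choose i : ℝ) ≤ ∑ i ∈ Finset.range n, (M.choose i : ℝ)
        + ∑ i ∈ Finset.range (M + 1) \ Finset.range n, (M.choose i : ℝ) := by
      rw [← Finset.sum_union Finset.disjoint_sdiff, Finset.union_sdiff_self_eq_union]
      exact Finset.sum_le_sum_of_subset_of_nonneg Finset.subset_union_right fun _ _ _ => by positivity
    have h3 : ∑ i ∈ Finset.range (M + 1) \ Finset.range n, (M.choose i : ℝ) ≤
        ∑ i ∈ Finset.range (M + 1), (M.choose i : ℝ) * Real.exp (2 * s * (i - n)) := by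
      calc _ ≤ ∑ i ∈ Finset.range (M + 1) \ Finset.range n,
            (M.choose i : ℝ) * Real.exp (2 * s * (i - n)) := by
            refine Finset.sum_le_sum fun i hi => ?_
            have hi : (n : ℝ) ≤ i := by
              simp only [Finset.mem_sdiff, Finset.mem_range, not_lt] at hi
              exact_mod_cast hi.2
            refine le_mul_of_one_le_right (by positivity) (Real.one_le_exp ?_)
            exact mul_nonneg (by positivity) (by linarith)
        _ ≤ _ := Finset.sum_le_sum_of_subset_of_nonneg Finset.sdiff_subset
            fun _ _ _ => by positivity
    linarith
  have h4 : ∑ i ∈ Finset.range (M + 1), (M.choose i : ℝ) * Real.exp (2 * s * (i - n)) =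
      2 ^ M * (Real.exp s * Real.cosh s) ^ M * Real.exp (-(2 * s * n)) := by
    have h5 : 2 * (Real.exp s * Real.cosh s) = Real.exp (2 * s) + 1 := by
      rw [Real.cosh_eq, Real.exp_neg, two_mul s, Real.exp_add]
      field_simp
    rw [← mul_pow, h5, add_pow, Finset.sum_mul]
    refine Finset.sum_congr rfl fun i _ => ?_
    rw [← Real.exp_nat_mul, one_pow, mul_one, mul_comm (Real.exp _) (M.choose i : ℝ),
      mul_assoc (M.choose i : ℝ),
      ← Real.exp_add]
    ring_nf
  have h6 : (Real.exp s * Real.cosh s) ^ M ≤ Real.exp (M * (s + s ^ 2 / 2)) := by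
    rw [Real.exp_nat_mul, Real.exp_add]
    have := Real.cosh_le_exp_half_sq s
    have := Real.cosh_pos s
    gcongr
  rw [h4] at h1
  have h7 : (0 : ℝ) < 2 ^ M := by positivity
  calc 1 - (∑ i ∈ Finset.range n, (M.choose i : ℝ)) / 2 ^ M
      = (2 ^ M - ∑ i ∈ Finset.range n, (M.choose i : ℝ)) / 2 ^ M := by field_simp
    _ ≤ (Real.exp s * Real.cosh s) ^ M * Real.exp (-(2 * s * n)) := by
        rw [div_le_iff₀ h7]; linarith
    _ ≤ Real.exp (M * (s + s ^ 2 / 2)) * Real.exp (-(2 * s * n)) := by gcongr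
    _ = _ := by rw [← Real.exp_add]; ring_nf

/-! ### Threshold behaviour in `β` -/

theorem ConvergesExponentially.tendsto {a : ℕ → ℝ} {l : ℝ} (h : ConvergesExponentially a l) :
    Tendsto a atTop (nhds l) := by
  obtain ⟨c, hc, h⟩ := h
  rw [tendsto_iff_dist_tendsto_zero]
  refine squeeze_zero' (Eventually.of_forall fun _ => dist_nonneg) h ?_
  refine Real.tendsto_exp_atBot.comp ?_
  exact tendsto_natCast_atTop_atTop.const_mul_atTop_of_neg (neg_neg_of_pos hc)

section Threshold

variable {p : ℕ → ℕ → ℝ} {β : ℝ} {K : ℕ → ℕ}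

theorem convergesExponentially_of_wendel
    (hp : ∀ n N : ℕ, 1 ≤ n → 1 ≤ N →
      p n N = (∑ i ∈ Finset.range n, ((N - 1).choose i : ℝ)) / 2 ^ (N - 1))
    (hK : ∀ n : ℕ, K n = ⌊β * n⌋₊ ∨ K n = ⌈β * n⌉₊) (h1 : 1 < β) (h2 : β < 2) :
    ConvergesExponentially (fun n => p n (K n)) 1 := by
  -- Not the optimal tilt, but with `β = 2 - 2 * s` the rate below becomes `s ^ 2 + s ^ 3`, which is
  -- positive.
  set s : ℝ := (2 - β) / 2 with hs
  have hs0 : 0 < s := by rw [hs]; linarith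
  refine ⟨2 * s - β * (s + s ^ 2 / 2), ?_, ?_⟩
  · have : β = 2 - 2 * s := by rw [hs]; ring
    rw [this]
    nlinarith [mul_pos hs0 hs0, mul_pos (mul_pos hs0 hs0) hs0]
  · filter_upwards [eventually_ge_atTop 1] with n hn
    have hn0 : (1 : ℝ) ≤ n := by exact_mod_cast hn
    have hb : 1 ≤ β * n := by nlinarith
    have hKpos : 1 ≤ K n := by
      have : 1 ≤ ⌊β * n⌋₊ := Nat.le_floor (by simpa using hb)
      have := Nat.floor_le_ceil (β * n)
      rcases hK n with h | h <;> omega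
    have hKle : ((K n - 1 : ℕ) : ℝ) ≤ β * n := by
      rw [Nat.cast_sub hKpos]
      have := Nat.ceil_lt_add_one (show 0 ≤ β * n by linarith)
      have := Nat.floor_le (show 0 ≤ β * n by linarith)
      rcases hK n with h | h <;> rw [h] <;> push_cast <;> linarith
    rw [hp n _ hn hKpos, abs_sub_comm, abs_of_nonneg]
    · refine (one_sub_sum_range_choose_le n (K n - 1) hs0.le).trans (Real.exp_le_exp.2 ?_)
      have : ((K n - 1 : ℕ) : ℝ) * (s + s ^ 2 / 2) ≤ β * n * (s + s ^ 2 / 2) := by gcongr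
      linarith
    · rw [sub_nonneg, div_le_one (by positivity)]
      rcases lt_or_ge (K n - 1) n with h | h
      · exact_mod_cast (sum_range_choose_of_lt h).le
      · exact_mod_cast (sum_range_choose_lt h).le

theorem eventually_lt_one_of_wendel
    (hp : ∀ n N : ℕ, 1 ≤ n → 1 ≤ N →
      p n N = (∑ i ∈ Finset.range n, ((N - 1).choose i : ℝ)) / 2 ^ (N - 1))
    (hK : ∀ n : ℕ, K n = ⌊β * n⌋₊ ∨ K n = ⌈β * n⌉₊) (h1 : 1 < β) :
    ∀ᶠ n : ℕ in atTop, p n (K n) < 1 := by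
  have ht := (tendsto_natCast_atTop_atTop (R := ℝ)).const_mul_atTop (sub_pos.2 h1)
  filter_upwards [eventually_ge_atTop 1, ht.eventually_ge_atTop 1] with n hn hb
  have hKn : n + 1 ≤ K n := by
    have : n + 1 ≤ ⌊β * n⌋₊ := Nat.le_floor (by push_cast; linarith)
    have := Nat.floor_le_ceil (β * n)
    rcases hK n with h | h <;> omega
  rw [hp n _ hn (by omega), div_lt_one (by positivity)]
  exact_mod_cast sum_range_choose_lt (show n ≤ K n - 1 by omega)

theorem not_convergesExponentially_of_wendel
    (hp : ∀ n N : ℕ, 1 ≤ n → 1 ≤ N →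
      p n N = (∑ i ∈ Finset.range n, ((N - 1).choose i : ℝ)) / 2 ^ (N - 1))
    (hK : ∀ n : ℕ, K n = ⌊β * n⌋₊ ∨ K n = ⌈β * n⌉₊) (h2 : 2 ≤ β) :
    ¬ ConvergesExponentially (fun n => p n (K n)) 1 := by
  intro h
  -- The limit would be `1`, yet every term with `n ≥ 1` is at most `1/2`.
  have : (1 : ℝ) ≤ 1 / 2 := by
    refine le_of_tendsto h.tendsto ?_
    filter_upwards [eventually_ge_atTop 1] with n hn
    have hKn : 2 * n ≤ K n := by
      have : 2 * n ≤ ⌊β * n⌋₊ := Nat.le_floor (by push_cast; gcongr)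
      have := Nat.floor_le_ceil (β * n)
      rcases hK n with h | h <;> omega
    rw [hp n _ hn (by omega), div_le_div_iff₀ (by positivity) (by positivity)]
    have : 2 * ∑ i ∈ Finset.range n, ((K n - 1).choose i : ℝ) ≤ 2 ^ (K n - 1) := by
      exact_mod_cast two_mul_sum_range_choose_le (show 2 * n ≤ K n - 1 + 1 by omega)
    linarith
  norm_num at this

theorem eq_one_of_wendel
    (hp : ∀ n N : ℕ, 1 ≤ n → 1 ≤ N →
      p n N = (∑ i ∈ Finset.range n, ((N - 1).choose i : ℝ)) / 2 ^ (N - 1))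
    (hp0 : ∀ n : ℕ, 1 ≤ n → p n 0 = 1)
    (hK : ∀ n : ℕ, K n = ⌊β * n⌋₊ ∨ K n = ⌈β * n⌉₊) (h1 : β ≤ 1) {n : ℕ} (hn : 1 ≤ n) :
    p n (K n) = 1 := by
  have hKn : K n ≤ n := by
    have : ⌈β * n⌉₊ ≤ n := Nat.ceil_le.2 (mul_le_of_le_one_left (Nat.cast_nonneg n) h1)
    have := Nat.floor_le_ceil (β * n)
    rcases hK n with h | h <;> omega
  -- Rounding down can leave no points at all, a case outside Wendel's formula.
  rcases Nat.eq_zero_or_pos (K n) with h | h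
  · rw [h, hp0 n hn]
  · rw [hp n _ hn h, div_eq_one_iff_eq (by positivity)]
    exact_mod_cast sum_range_choose_of_lt (show K n - 1 < n by omega)

end Threshold

theorem mainTheorem1 :
    -- Wendel's formula
    (∀ n N : ℕ, 1 ≤ n → 1 ≤ N →
      hemisphericalProb n N =
        (∑ i ∈ Finset.range n, ((N - 1).choose i : ℝ)) / 2 ^ (N - 1)) ∧
    -- `K n` is `β n`, rounded arbitrarily to a neighbouring integer
    ∀ β : ℝ, 0 < β → ∀ K : ℕ → ℕ, (∀ n : ℕ, K n = ⌊β * n⌋₊ ∨ K n = ⌈β * n⌉₊) →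
      -- nondegenerate exponential convergence to `1`
      ((ConvergesExponentially (fun n => hemisphericalProb n (K n)) 1 ∧
          ∀ᶠ n : ℕ in atTop, hemisphericalProb n (K n) < 1) ↔ 1 < β ∧ β < 2) ∧
      (1 < β →
        (ConvergesExponentially (fun n => hemisphericalProb n (K n)) 1 ↔ β < 2)) ∧
      (β ≤ 1 → ∀ n : ℕ, 1 ≤ n → hemisphericalProb n (K n) = 1) := by
  refine ⟨fun n N => hemisphericalProb_eq, fun β _ K hK => ?_⟩
  have hW : ∀ n N : ℕ, 1 ≤ n → 1 ≤ N → hemisphericalProb n N =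
      (∑ i ∈ Finset.range n, ((N - 1).choose i : ℝ)) / 2 ^ (N - 1) := fun _ _ => hemisphericalProb_eq
  have hone (h : β ≤ 1) (n : ℕ) (hn : 1 ≤ n) : hemisphericalProb n (K n) = 1 :=
    eq_one_of_wendel hW (fun _ => hemisphericalProb_zero) hK h hn
  have htwo (h : ConvergesExponentially (fun n => hemisphericalProb n (K n)) 1) : β < 2 :=
    lt_of_not_ge fun h2 => not_convergesExponentially_of_wendel hW hK h2 h
  refine ⟨⟨fun ⟨h1, h2⟩ => ⟨?_, htwo h1⟩, fun ⟨h1, h2⟩ =>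
    ⟨convergesExponentially_of_wendel hW hK h1 h2, eventually_lt_one_of_wendel hW hK h1⟩⟩,
    fun h1 => ⟨htwo, convergesExponentially_of_wendel hW hK h1⟩, hone⟩
  by_contra! h
  obtain ⟨n, hn, hlt⟩ := ((eventually_ge_atTop 1).and h2).exists
  exact hlt.ne (hone h n hn)
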